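/- **Lemma 6.1.** Let $n\ge 1$, let $(M,g)$ be a globally hyperbolic (smooth, time-oriented Lorentzian) spacetime of dimension $n+1$, and let $t:M\to(0,\infty)$ be a surjective smooth Cauchy time function: $dt(v)>0$ for every future-directed causal vector $v$, and every level set of $t$ is a Cauchy hypersurface. Let $M=(0,\infty)\times\mathcal S$ be a topological splitting whose first projection is $t$. Let $t_L>0$. By an *adapted chart* we mean smooth coordinates $(t,x^1,\dots,x^n)$ on $(0,t_L)\times U\subseteq M$, for some open $U\subseteq\mathcal S$, where the $x^i$ are functions on $U$, each with values in $\mathbb R$ or (periodic coordinate) in a circle $\mathbb R/T_i\mathbb Z$, such that $$g=g_{00}(t,x)\,dt^2+\sum_{i,j=1}^n g_{ij}(t,x)\,dx^i dx^j,\qquad g_{00}<0,$$ and such that, uniformly for $x$ in compact subsets of $U$, $$g_{11}\to\infty,\qquad g_{ij}\to0\ \text{ for }(i,j)\ne(1,1),\qquad\text{as } t\to0,$$ and either $g_{1i}=0$ for all $i\ne1$, or $$\frac{g_{mi}g_{mj}}{g_{mm}g_{ij}}\to0\quad\text{as } t\to0,\ \text{ for all } i,j<m,$$ uniformly for $x$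 in compact subsets of $U$ (that is, $g_{mi}g_{mj}=o(g_{mm}g_{ij})$, also where $g_{ij}$ has zeros). Suppose that $\{t<t_L\}$ is covered by adapted charts, and that either * $\mathcal S$ is compact and $\{t<t_L\}$ is covered by a single adapted chart ($U=\mathcal S$), or * for every $p\in\{t<t_L\}$ there are an adapted chart on some $(0,t_L)\times U$ and a compact set $K_p\subseteq U$ such that $I^-(p,M)\subseteq(0,t_L)\times K_p$. Then $(M,g)$ contains an expanding singularity towards the past. That is, there exist a smooth Cauchy time function $t'$ (in the above sense) with range $(0,\infty)$ and a number $t'_L>0$ such that for every $p\in\{t'<t'_L\}$ and every $q\in I^-(p,M)$ there is a sequence $t_i>0$ strictly decreasing to zero with $$\operatorname{diam}\bigl(I^-(q,M)\cap\{t'=t_i\},\ I^-(p,M)\cap\{t'=t_i\}\bigr)\to\infty .$$ Here $\operatorname{diam}(A,B):=\sup_{x,y\in A}\inf_\gamma\int_0^1|\dot\gamma(s)|_g\,ds$, where $\gamma$ runs over the piecewise smooth curves $\gamma:[0,1]\to B$ from $x$ to $y$, with $\inf\emptyset=\infty$, and $I^-$ is defined by piecewise smooth timelike curves. -/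

import Mathlib

open Set Filter Topology MeasureTheory
open scoped Manifold ContDiff Bundle ENNReal

/-! ### Spacetimes -/

section Spacetime

variable (d : ℕ) (M : Type*) [TopologicalSpace M] [ChartedSpace (EuclideanSpace ℝ (Fin d)) M]
  [IsManifold (𝓡 d) ∞ M]

/-- A smooth Lorentzian metric, of signature `(-,+,…,+)`, on a smooth `d`-manifold `M`. -/
structure LorentzianMetric where
  /-- The bilinear form on each tangent space. -/
  val : ∀ p : M, TangentSpace (𝓡 d) p →L[ℝ] TangentSpace (𝓡 d) p →L[ℝ] ℝ
  symm : ∀ (p : M) (v w : TangentSpace (𝓡 d) p), val p v w = val p w v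
  /-- There is a timelike vector whose orthogonal complement is positive definite. -/
  signature : ∀ p : M, ∃ v : TangentSpace (𝓡 d) p, val p v v < 0 ∧
    ∀ w : TangentSpace (𝓡 d) p, w ≠ 0 → val p v w = 0 → 0 < val p w w
  contMDiff : ContMDiff (𝓡 d)
    ((𝓡 d).prod 𝓘(ℝ, EuclideanSpace ℝ (Fin d) →L[ℝ] EuclideanSpace ℝ (Fin d) →L[ℝ] ℝ)) ∞
    (fun p : M ↦ Bundle.TotalSpace.mk'
      (EuclideanSpace ℝ (Fin d) →L[ℝ] EuclideanSpace ℝ (Fin d) →L[ℝ] ℝ)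
      (E := fun p : M ↦ TangentSpace (𝓡 d) p →L[ℝ] TangentSpace (𝓡 d) p →L[ℝ] ℝ) p (val p))

/-- A Lorentzian metric together with a time orientation, given by a continuous timelike
vector field. -/
structure Spacetime extends LorentzianMetric d M where
  /-- The vector field that defines the time orientation; it is future directed. -/
  orient : ∀ p : M, TangentSpace (𝓡 d) p
  orient_continuous : Continuous (fun p : M ↦ (⟨p, orient p⟩ : TangentBundle (𝓡 d) M))
  orient_timelike : ∀ p : M, val p (orient p) (orient p) < 0

end Spacetime

/-! ### Piecewise smooth curves -/

/-- `[a, b]` has a partition `a = s₀ < s₁ < … < s_{k+1} = b` into finitely many intervals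
`[c, e]` on each of which `P c e` holds. -/
def HasPartition (P : ℝ → ℝ → Prop) (a b : ℝ) : Prop :=
  ∃ (k : ℕ) (s : Fin (k + 2) → ℝ), StrictMono s ∧ s 0 = a ∧ s (Fin.last (k + 1)) = b ∧
    ∀ i : Fin (k + 1), P (s i.castSucc) (s i.succ)

section Curves

variable {d : ℕ} {M : Type*} [TopologicalSpace M] [ChartedSpace (EuclideanSpace ℝ (Fin d)) M]

/-- The velocity at the parameter `s` of the curve `γ` defined on `[a, b]`
(one-sided at the end points). -/
noncomputable def curveVelocity (γ : ℝ → M) (a b s : ℝ) : TangentSpace (𝓡 d) (γ s) :=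
  mfderivWithin 𝓘(ℝ, ℝ) (𝓡 d) γ (Icc a b) s (1 : ℝ)

variable (d) in
/-- `γ` is piecewise smooth on `[a, b]`. In particular, it is continuous there. -/
def IsPiecewiseSmooth (γ : ℝ → M) (a b : ℝ) : Prop :=
  HasPartition (fun c e ↦ ContMDiffOn 𝓘(ℝ, ℝ) (𝓡 d) ∞ γ (Icc c e)) a b

end Curves

namespace Spacetime

variable {d : ℕ} {M : Type*} [TopologicalSpace M] [ChartedSpace (EuclideanSpace ℝ (Fin d)) M]
  [IsManifold (𝓡 d) ∞ M] (g : Spacetime d M)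

/-! ### Causality -/

/-- `v` is timelike and future directed. -/
def IsFutureTimelike {p : M} (v : TangentSpace (𝓡 d) p) : Prop :=
  g.val p v v < 0 ∧ g.val p (g.orient p) v < 0

/-- `v` is causal (timelike or null, and nonzero) and future directed. -/
def IsFutureCausal {p : M} (v : TangentSpace (𝓡 d) p) : Prop :=
  v ≠ 0 ∧ g.val p v v ≤ 0 ∧ g.val p (g.orient p) v < 0

/-- `γ` is a piecewise smooth future directed timelike curve on `[a, b]`. -/
def IsFutureTimelikeCurve (γ : ℝ → M) (a b : ℝ) : Prop :=
  HasPartition (fun c e ↦ ContMDiffOn 𝓘(ℝ, ℝ) (𝓡 d) ∞ γ (Icc c e) ∧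
    ∀ s ∈ Icc c e, g.IsFutureTimelike (curveVelocity γ c e s)) a b

/-- The timelike past `I⁻(p, M)`. -/
def timelikePast (p : M) : Set M :=
  {q | ∃ (γ : ℝ → M) (a b : ℝ), g.IsFutureTimelikeCurve γ a b ∧ γ a = q ∧ γ b = p}

/-- `γ` is an inextendible (future directed, piecewise smooth) timelike curve. Every open
interval can be reparametrized to `ℝ`, so only curves defined on `ℝ` are considered. -/
def IsInextendibleTimelikeCurve (γ : ℝ → M) : Prop :=
  (∀ a b : ℝ, a < b → g.IsFutureTimelikeCurve γ a b) ∧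
    (¬ ∃ p : M, Tendsto γ atTop (𝓝 p)) ∧ ¬ ∃ p : M, Tendsto γ atBot (𝓝 p)

/-- A Cauchy hypersurface: a set that every inextendible timelike curve meets exactly once. -/
def IsCauchyHypersurface (C : Set M) : Prop :=
  ∀ γ : ℝ → M, g.IsInextendibleTimelikeCurve γ → ∃! s : ℝ, γ s ∈ C

/-- Global hyperbolicity: there is a Cauchy hypersurface. -/
def IsGloballyHyperbolic : Prop :=
  ∃ C : Set M, g.IsCauchyHypersurface C

/-- `t` is a smooth Cauchy time function that ranges over `(0, ∞)`. -/
structure IsCauchyTimeFunction (t : M → ℝ) : Prop where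
  contMDiff : ContMDiff (𝓡 d) 𝓘(ℝ, ℝ) ∞ t
  range_eq : range t = Ioi 0
  /-- `t` increases in every future causal direction: its gradient is timelike. -/
  increasing : ∀ (p : M) (v : TangentSpace (𝓡 d) p), g.IsFutureCausal v →
    (0 : ℝ) < mfderiv (𝓡 d) 𝓘(ℝ, ℝ) t p v
  cauchy : ∀ c : ℝ, 0 < c → g.IsCauchyHypersurface {p | t p = c}

/-! ### Diameters within slices and expanding singularities -/

/-- The length `∫₀¹ |γ'(s)|_g ds` of `γ : [0, 1] → M`. It is used only for curves within a level
set of a time function, where `g (γ', γ') ≥ 0`: there it is the Riemannian length for the metric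
induced on the level set. -/
noncomputable def curveLength (γ : ℝ → M) : ℝ≥0∞ :=
  ∫⁻ s in Icc (0 : ℝ) 1, ENNReal.ofReal
    (Real.sqrt (g.val (γ s) (curveVelocity γ 0 1 s) (curveVelocity γ 0 1 s)))

/-- The diameter of `A` in `B`: the supremum over `x, y ∈ A` of the infimum of the lengths of
the piecewise smooth curves from `x` to `y` within `B` (`∞` if there is no such curve). -/
noncomputable def diamIn (A B : Set M) : ℝ≥0∞ :=
  ⨆ x ∈ A, ⨆ y ∈ A, ⨅ (γ : ℝ → M) (_ : IsPiecewiseSmooth d γ 0 1 ∧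
    (∀ s ∈ Icc (0 : ℝ) 1, γ s ∈ B) ∧ γ 0 = x ∧ γ 1 = y), g.curveLength γ

/-- The globally hyperbolic spacetime `(M, g)` contains an expanding singularity towards
the past. -/
def HasExpandingSingularityTowardsPast : Prop :=
  g.IsGloballyHyperbolic ∧
  ∃ t : M → ℝ, g.IsCauchyTimeFunction t ∧ ∃ tL : ℝ, 0 < tL ∧
    ∀ p : M, t p < tL → ∀ q ∈ g.timelikePast p,
      ∃ τ : ℕ → ℝ, StrictAnti τ ∧ (∀ i, 0 < τ i) ∧ Tendsto τ atTop (𝓝 0) ∧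
        Tendsto (fun i ↦ g.diamIn (g.timelikePast q ∩ {r | t r = τ i})
          (g.timelikePast p ∩ {r | t r = τ i})) atTop (𝓝 (⊤ : ℝ≥0∞))

end Spacetime

/-! ### Adapted charts -/

section Charts

variable {n : ℕ} {M : Type*} [TopologicalSpace M]
  [ChartedSpace (EuclideanSpace ℝ (Fin (n + 1))) M] [IsManifold (𝓡 (n + 1)) ∞ M]
  {S : Type*} [TopologicalSpace S]

/-- Coordinates `(t, x¹, …, xⁿ)` on `(0, tL) × U`, with `U` open in `S`, for a splitting
`Ψ : M ≃ (0, ∞) × S`, in which `g = g₀₀ dt² + gᵢⱼ dxⁱ dxʲ` with `g₀₀ < 0`. Each coordinate `xⁱ`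
takes values in `ℝ` (`period i = 0`) or in the circle `ℝ / period i ℤ` (`period i > 0`).
The coordinates are given by their inverse `param`, as a function that is periodic in the
periodic coordinates: it induces a diffeomorphism from the quotient of `(0, tL) × V` by the
periods to the subset `(0, tL) × U` of `M`. If all periods are `0`, then this is a chart in the
usual sense. -/
structure AdaptedChart (g : Spacetime (n + 1) M) (Ψ : M ≃ₜ Ioi (0 : ℝ) × S) (tL : ℝ) where
  U : Set S
  isOpen_U : IsOpen U
  period : Fin n → ℝ
  period_nonneg : ∀ i, 0 ≤ period i
  V : Set (Fin n → ℝ)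
  isOpen_V : IsOpen V
  periodic_V : ∀ x ∈ V, ∀ y : Fin n → ℝ, (∀ i, ∃ k : ℤ, y i = x i + k * period i) → y ∈ V
  /-- The spatial part of `param`. -/
  space : (Fin n → ℝ) → S
  image_space : space '' V = U
  space_eq_iff : ∀ x ∈ V, ∀ y ∈ V,
    space x = space y ↔ ∀ i, ∃ k : ℤ, y i = x i + k * period i
  param : ℝ × (Fin n → ℝ) → M
  splitting_param : ∀ τ ∈ Ioo 0 tL, ∀ x ∈ V,
    ((Ψ (param (τ, x))).1 : ℝ) = τ ∧ (Ψ (param (τ, x))).2 = space x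
  contMDiffOn_param :
    ContMDiffOn 𝓘(ℝ, ℝ × (Fin n → ℝ)) (𝓡 (n + 1)) ∞ param (Ioo 0 tL ×ˢ V)
  bijective_mfderiv : ∀ τ ∈ Ioo 0 tL, ∀ x ∈ V,
    Function.Bijective (mfderiv 𝓘(ℝ, ℝ × (Fin n → ℝ)) (𝓡 (n + 1)) param (τ, x))
  /-- `g₀₀ < 0`. -/
  time_time_neg : ∀ τ ∈ Ioo 0 tL, ∀ x ∈ V,
    g.val (param (τ, x))
      (mfderiv 𝓘(ℝ, ℝ × (Fin n → ℝ)) (𝓡 (n + 1)) param (τ, x) ((1, 0) : ℝ × (Fin n → ℝ)))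
      (mfderiv 𝓘(ℝ, ℝ × (Fin n → ℝ)) (𝓡 (n + 1)) param (τ, x) ((1, 0) : ℝ × (Fin n → ℝ))) < 0
  /-- `g₀ᵢ = 0`. -/
  time_space_zero : ∀ τ ∈ Ioo 0 tL, ∀ x ∈ V, ∀ i : Fin n,
    g.val (param (τ, x))
      (mfderiv 𝓘(ℝ, ℝ × (Fin n → ℝ)) (𝓡 (n + 1)) param (τ, x) ((1, 0) : ℝ × (Fin n → ℝ)))
      (mfderiv 𝓘(ℝ, ℝ × (Fin n → ℝ)) (𝓡 (n + 1)) param (τ, x)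
        ((0, Pi.single i 1) : ℝ × (Fin n → ℝ))) = 0

namespace AdaptedChart

variable {g : Spacetime (n + 1) M} {Ψ : M ≃ₜ Ioi (0 : ℝ) × S} {tL : ℝ}

/-- The spatial metric component `gᵢⱼ(τ, x)`. -/
noncomputable def comp (c : AdaptedChart g Ψ tL) (i j : Fin n) (τ : ℝ) (x : Fin n → ℝ) : ℝ :=
  g.val (c.param (τ, x))
    (mfderiv 𝓘(ℝ, ℝ × (Fin n → ℝ)) (𝓡 (n + 1)) c.param (τ, x)
      ((0, Pi.single i 1) : ℝ × (Fin n → ℝ)))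
    (mfderiv 𝓘(ℝ, ℝ × (Fin n → ℝ)) (𝓡 (n + 1)) c.param (τ, x)
      ((0, Pi.single j 1) : ℝ × (Fin n → ℝ)))

/-- The asymptotic conditions on the metric as `t → 0`, uniformly for `x` in compact subsets `K`
of `U`. The index `0 : Fin n` stands for the expanding direction `x¹`. -/
structure IsExpanding [NeZero n] (c : AdaptedChart g Ψ tL) : Prop where
  /-- `g₁₁ → ∞`. -/
  diverges : ∀ K : Set S, IsCompact K → K ⊆ c.U → ∀ C : ℝ,
    ∀ᶠ τ in 𝓝[>] (0 : ℝ), ∀ x ∈ c.V, c.space x ∈ K → C ≤ c.comp 0 0 τ x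
  /-- `gᵢⱼ → 0` for `(i, j) ≠ (1, 1)`. -/
  decays : ∀ i j : Fin n, (i, j) ≠ (0, 0) → ∀ K : Set S, IsCompact K → K ⊆ c.U → ∀ ε > 0,
    ∀ᶠ τ in 𝓝[>] (0 : ℝ), ∀ x ∈ c.V, c.space x ∈ K → |c.comp i j τ x| ≤ ε
  /-- Either `g₁ᵢ = 0` for all `i ≠ 1`, or `gₘᵢ gₘⱼ / (gₘₘ gᵢⱼ) → 0` for all `i, j < m`.
  The quotient is written without division, as `gₘᵢ gₘⱼ = o(gₘₘ gᵢⱼ)`. -/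
  offDiagonal :
    (∀ i : Fin n, i ≠ 0 → ∀ τ ∈ Ioo 0 tL, ∀ x ∈ c.V, c.comp 0 i τ x = 0) ∨
    (∀ m i j : Fin n, i < m → j < m → ∀ K : Set S, IsCompact K → K ⊆ c.U → ∀ ε > 0,
      ∀ᶠ τ in 𝓝[>] (0 : ℝ), ∀ x ∈ c.V, c.space x ∈ K →
        |c.comp m i τ x * c.comp m j τ x| ≤ ε * |c.comp m m τ x * c.comp i j τ x|)

end AdaptedChart

end Charts

/-!
The time function `t` itself witnesses the expanding singularity, with the same bound `tL`, and the
diameters tend to infinity along the whole limit `t → 0`. Fix `q ∈ I⁻(p)` and an adapted chart in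
which `I⁻(p)` lies over a compact set `K`.

*Lower bound for lengths.* The case `i = j` of the off-diagonal condition says
`gₘᵢ² = o(gₘₘ gᵢᵢ)`, so for small `t` the mixed terms are absorbed by the diagonal, and
`gᵢⱼ vⁱ vʲ ≥ ½ g₁₁ (v¹)²` over `K`; if `g₁ᵢ = 0`, then this is clear
(`AdaptedChart.IsExpanding.eventually_le_spatial`). Both cases use that the slices are spacelike,
which holds since they are orthogonal to the timelike `∂ₜ`
(`LorentzianMetric.pos_of_orthogonal`). As `g₁₁ → ∞`, a curve in a slice of `I⁻(p)` is much longer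
than the change of `x¹` along it (`AdaptedChart.mul_abs_sub_le_curveLength`). Since `x¹` may be
periodic, lengths are compared with a function `φ(x¹)` instead, where `φ` has slope at most one and
the period of `x¹`; it descends to the spacetime, so that curves need not be lifted.

*The past of `q` does not shrink.* A curve that goes down from `q`, moves sideways a little
during a fixed time interval and then follows `∂ₜ` is timelike. So for a fixed small `h`, the
slices of `I⁻(q)` contain both `(t, x)` and `(t, x + h e₁)` for all small `t`
(`AdaptedChart.eventually_param_mem_timelikePast`), and `φ(x¹)` separates these points.
-/

/-! ### Linear algebra of Lorentzian forms -/

section Algebra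

/-- The orthogonal complement of *every* timelike vector is spacelike, whereas the signature
condition only provides one such vector `v`: if `w ⊥ u` were not spacelike, then the plane of
`u` and `w` would be negative semidefinite, but it contains a vector orthogonal to `v`. -/
theorem LorentzianMetric.pos_of_orthogonal {d : ℕ} {M : Type*} [TopologicalSpace M]
    [ChartedSpace (EuclideanSpace ℝ (Fin d)) M] [IsManifold (𝓡 d) ∞ M]
    (g : LorentzianMetric d M) {p : M} {u w : TangentSpace (𝓡 d) p}
    (hu : g.val p u u < 0) (hw : w ≠ 0) (huw : g.val p u w = 0) : 0 < g.val p w w := by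
  obtain ⟨v, -, hv⟩ := g.signature p
  by_contra! hneg
  have hwu : g.val p w u = 0 := by rw [g.symm]; exact huw
  have hz : g.val p v w • u - g.val p v u • w = 0 := by
    by_contra hz
    have h := hv _ hz (by simp; ring)
    simp only [map_sub, map_smul, _root_.sub_apply, _root_.smul_apply,
      smul_eq_mul, huw, hwu, mul_zero, sub_zero, zero_sub] at h
    nlinarith [mul_nonneg (sq_nonneg (g.val p v w)) (neg_nonneg.2 hu.le),
      mul_nonneg (sq_nonneg (g.val p v u)) (neg_nonneg.2 hneg)]
  have h := congrArg (g.val p u) hz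
  simp only [map_sub, map_smul, smul_eq_mul, huw, mul_zero, sub_zero, map_zero] at h
  exact hneg.not_gt (hv w hw ((mul_eq_zero.1 h).resolve_right hu.ne))

/-- If the off-diagonal entries of a square matrix with nonnegative diagonal are small
relative to the diagonal, then its quadratic form dominates half of each diagonal term. -/
theorem half_mul_sq_le_sum_of_offDiagonal_small {ι : Type*} [Fintype ι] [DecidableEq ι]
    (A : ι → ι → ℝ) (hdiag : ∀ i, 0 ≤ A i i) {δ : ℝ} (hδ : 0 ≤ δ)
    (hδι : δ * Fintype.card ι ≤ 1 / 2)
    (hoff : ∀ i j, i ≠ j → A i j ^ 2 ≤ δ ^ 2 * (A i i * A j j)) (k : ι) (v : ι → ℝ) :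
    1 / 2 * (A k k * v k ^ 2) ≤ ∑ i, ∑ j, A i j * (v i * v j) := by
  have hX : ∀ i, 0 ≤ A i i * v i ^ 2 := fun i ↦ mul_nonneg (hdiag i) (sq_nonneg _)
  have hterm : ∀ i j, (if i = j then A i i * v i ^ 2 else 0)
      - δ / 2 * (A i i * v i ^ 2 + A j j * v j ^ 2) ≤ A i j * (v i * v j) := by
    intro i j
    have hnn : 0 ≤ δ / 2 * (A i i * v i ^ 2 + A j j * v j ^ 2) :=
      mul_nonneg (by positivity) (add_nonneg (hX i) (hX j))
    split_ifs with hij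
    · subst hij
      nlinarith
    · have hsq : (A i j * (v i * v j)) ^ 2
          ≤ (δ / 2 * (A i i * v i ^ 2 + A j j * v j ^ 2)) ^ 2 := by
        have h := mul_le_mul_of_nonneg_right (hoff i j hij) (sq_nonneg (v i * v j))
        nlinarith [mul_nonneg (sq_nonneg δ) (sq_nonneg (A i i * v i ^ 2 - A j j * v j ^ 2))]
      have := neg_le_of_abs_le (abs_le_of_sq_le_sq hsq hnn)
      linarith
  have hsum := Finset.sum_le_sum fun i (_ : i ∈ Finset.univ) ↦
    Finset.sum_le_sum fun j (_ : j ∈ Finset.univ) ↦ hterm i j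
  refine le_trans ?_ hsum
  set D := ∑ i, A i i * v i ^ 2 with hDdef
  have hlhs : ∑ i, ∑ j, ((if i = j then A i i * v i ^ 2 else 0)
      - δ / 2 * (A i i * v i ^ 2 + A j j * v j ^ 2)) = D - δ * Fintype.card ι * D := by
    simp only [Finset.sum_sub_distrib, Finset.sum_ite_eq, Finset.mem_univ, if_true, mul_add,
      Finset.sum_add_distrib, Finset.sum_const, Finset.card_univ, nsmul_eq_mul,
      ← Finset.mul_sum, ← hDdef]
    ring
  rw [hlhs]
  have hD : A k k * v k ^ 2 ≤ D :=
    Finset.single_le_sum (f := fun i ↦ A i i * v i ^ 2) (fun i _ ↦ hX i) (Finset.mem_univ k)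
  have hD0 : 0 ≤ D := (hX k).trans hD
  nlinarith [mul_le_mul_of_nonneg_right hδι hD0]

/-- A nonnegative quadratic form with no mixed terms in the direction `k` dominates the diagonal
term of `k`. -/
theorem mul_sq_le_sum_of_mixed_eq_zero {ι : Type*} [Fintype ι] [DecidableEq ι]
    (A : ι → ι → ℝ) (k : ι) (hk : ∀ i, i ≠ k → A k i = 0 ∧ A i k = 0)
    (hA : ∀ w : ι → ℝ, 0 ≤ ∑ i, ∑ j, A i j * (w i * w j)) (v : ι → ℝ) :
    A k k * v k ^ 2 ≤ ∑ i, ∑ j, A i j * (v i * v j) := by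
  have h := hA (Function.update v k 0)
  have hi : ∀ i j, A i j * (v i * v j) = A i j * (Function.update v k 0 i * Function.update v k 0 j)
      + if i = k then (if j = k then A k k * v k ^ 2 else 0) else 0 := by
    intro i j
    by_cases hik : i = k <;> by_cases hjk : j = k
    · subst hik hjk; simp [sq]
    · subst hik; simp [hjk, (hk j hjk).1]
    · subst hjk; simp [hik, (hk i hik).2]
    · simp [hik, hjk]
  simp only [hi, Finset.sum_add_distrib]
  simpa using h

end Algebra

/-! ### Piecewise estimates on intervals -/

section Partitions

theorem HasPartition.mono {P Q : ℝ → ℝ → Prop} {a b : ℝ} (h : HasPartition P a b)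
    (hPQ : ∀ c e, P c e → Q c e) : HasPartition Q a b := by
  obtain ⟨k, s, hs, h0, h1, hP⟩ := h
  exact ⟨k, s, hs, h0, h1, fun i ↦ hPQ _ _ (hP i)⟩

theorem hasPartition_of_lt {P : ℝ → ℝ → Prop} {a b : ℝ} (hab : a < b) (h : P a b) :
    HasPartition P a b := by
  refine ⟨0, ![a, b], ?_, rfl, rfl, fun i ↦ ?_⟩
  · rw [Fin.strictMono_iff_lt_succ]
    intro i
    fin_cases i
    exact hab
  · fin_cases i
    exact h

/-- A transitive relation between end points passes from the pieces of a partition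
to the whole interval. -/
theorem HasPartition.rel_of_trans {P R : ℝ → ℝ → Prop} {a b : ℝ} (h : HasPartition P a b)
    (hPR : ∀ c e, P c e → R c e)
    (htrans : ∀ x y z, x < y → y < z → R x y → R y z → R x z) : R a b := by
  obtain ⟨k, s, hs, rfl, rfl, hP⟩ := h
  have key : ∀ i : Fin (k + 1), R (s 0) (s i.succ) := by
    intro i
    induction i using Fin.induction with
    | zero => exact hPR _ _ (hP 0)
    | succ i ih =>
      refine htrans _ _ _ (hs (Fin.succ_pos _)) (hs ?_) ih (hPR _ _ (hP i.succ))
      exact i.succ.castSucc_lt_succ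
  exact key (Fin.last k)

/-- A property that holds inside the pieces of a partition holds outside a countable set (in fact,
outside the finitely many division points). -/
theorem HasPartition.exists_countable {P : ℝ → ℝ → Prop} {Q : ℝ → Prop} {a b : ℝ}
    (h : HasPartition P a b) (hPQ : ∀ c e, P c e → ∀ s ∈ Ioo c e, Q s) :
    ∃ N : Set ℝ, N.Countable ∧ ∀ s ∈ Ioo a b \ N, Q s := by
  refine h.rel_of_trans (R := fun a b ↦ ∃ N : Set ℝ, N.Countable ∧ ∀ s ∈ Ioo a b \ N, Q s)
    (fun c e hce ↦ ⟨∅, countable_empty, fun s hs ↦ hPQ c e hce s hs.1⟩) ?_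
  rintro x y z - - ⟨N, hN, hQN⟩ ⟨N', hN', hQN'⟩
  refine ⟨insert y (N ∪ N'), (hN.union hN').insert y, fun s hs ↦ ?_⟩
  simp only [Set.mem_sdiff, mem_insert_iff, mem_union, not_or] at hs
  rcases lt_or_gt_of_ne hs.2.1 with h | h
  · exact hQN s ⟨⟨hs.1.1, h⟩, hs.2.2.1⟩
  · exact hQN' s ⟨⟨h, hs.1.2⟩, hs.2.2.2⟩

theorem HasPartition.continuousOn {X : Type*} [TopologicalSpace X] {f : ℝ → X} {a b : ℝ}
    (h : HasPartition (fun c e ↦ ContinuousOn f (Icc c e)) a b) : ContinuousOn f (Icc a b) := by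
  refine h.rel_of_trans (R := fun c e ↦ ContinuousOn f (Icc c e)) (fun _ _ h ↦ h) ?_
  intro x y z hxy hyz h1 h2
  rw [← Icc_union_Icc_eq_Icc hxy.le hyz.le]
  exact h1.union_of_isClosed h2 isClosed_Icc isClosed_Icc

/-- The variation of a continuous, piecewise differentiable function is at most the integral of
the absolute value of its derivative, also if that integral is infinite. -/
theorem ofReal_abs_sub_le_lintegral_abs_deriv {f : ℝ → ℝ} {a b : ℝ} (hab : a ≤ b)
    {N : Set ℝ} (hN : N.Countable) (hc : ContinuousOn f (Icc a b))
    (hd : ∀ s ∈ Ioo a b \ N, DifferentiableAt ℝ f s) :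
    ENNReal.ofReal |f b - f a| ≤ ∫⁻ s in Icc a b, ENNReal.ofReal |deriv f s| := by
  by_cases htop : ∫⁻ s in Icc a b, ENNReal.ofReal |deriv f s| = ⊤
  · rw [htop]; exact le_top
  have hint : IntegrableOn (deriv f) (Icc a b) := by
    refine ⟨(measurable_deriv f).aestronglyMeasurable, ?_⟩
    simpa [HasFiniteIntegral, ← ofReal_norm, Real.norm_eq_abs] using
      lt_top_iff_ne_top.2 htop
  have hint' : IntervalIntegrable (deriv f) volume a b := by
    rw [intervalIntegrable_iff_integrableOn_Icc_of_le hab]; exact hint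
  have hftc := MeasureTheory.integral_eq_of_hasDerivAt_off_countable_of_le f (deriv f) hab hN hc
    (fun s hs ↦ (hd s hs).hasDerivAt) hint'
  rw [← hftc, intervalIntegral.integral_of_le hab, ← integral_Icc_eq_integral_Ioc]
  have h := enorm_integral_le_lintegral_enorm (μ := volume.restrict (Icc a b)) (deriv f)
  simpa [← ofReal_norm, Real.norm_eq_abs] using h

end Partitions

/-! ### Differentiability read in a parametrization -/

/-- If `P` parametrizes the manifold `M` and is a local diffeomorphism at `z`, then a function
on `M` is differentiable at `P z` as soon as it is so in the parametrization. -/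
theorem MDifferentiableAt.of_comp_param {d : ℕ} {M : Type*} [TopologicalSpace M]
    [ChartedSpace (EuclideanSpace ℝ (Fin d)) M] [IsManifold (𝓡 d) ∞ M]
    {E : Type*} [NormedAddCommGroup E] [NormedSpace ℝ E] [CompleteSpace E]
    {P : E → M} {z : E} (hP : ContMDiffAt 𝓘(ℝ, E) (𝓡 d) ∞ P z)
    (hbij : Function.Bijective (mfderiv 𝓘(ℝ, E) (𝓡 d) P z))
    {F : M → ℝ} (hF : DifferentiableAt ℝ (F ∘ P) z) :
    MDifferentiableAt (𝓡 d) 𝓘(ℝ, ℝ) F (P z) := by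
  set h : E → EuclideanSpace ℝ (Fin d) := extChartAt (𝓡 d) (P z) ∘ P
  have hh : ContDiffAt ℝ ∞ h z := by
    rw [← contMDiffAt_iff_contDiffAt]
    exact (contMDiffAt_extChartAt (n := ∞)).comp z hP
  have hderiv : fderiv ℝ h z = mfderiv 𝓘(ℝ, E) (𝓡 d) P z := by
    rw [(hP.mdifferentiableAt (by simp)).mfderiv]
    simp only [writtenInExtChartAt, mfld_simps, fderivWithin_univ]
    rfl
  let L : E ≃L[ℝ] EuclideanSpace ℝ (Fin d) :=
    ContinuousLinearEquiv.ofBijective (fderiv ℝ h z)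
      (by rw [LinearMap.ker_eq_bot, hderiv]; exact hbij.1)
      (by rw [LinearMap.range_eq_top, hderiv]; exact hbij.2)
  have hL : HasFDerivAt h (L : E →L[ℝ] EuclideanSpace ℝ (Fin d)) z :=
    (hh.differentiableAt (by simp)).hasFDerivAt
  have hn : (∞ : WithTop ℕ∞) ≠ 0 := by simp
  set j := hh.localInverse hL hn
  have hjz : j (extChartAt (𝓡 d) (P z) (P z)) = z := hh.localInverse_apply_image hL hn
  have hj : ContDiffAt ℝ ∞ j (extChartAt (𝓡 d) (P z) (P z)) := hh.to_localInverse hL hn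
  have hcont : ContinuousAt (extChartAt (𝓡 d) (P z)) (P z) := continuousAt_extChartAt (P z)
  have hjc : Tendsto (fun r ↦ j (extChartAt (𝓡 d) (P z) r)) (𝓝 (P z)) (𝓝 z) := by
    have := hj.continuousAt.tendsto.comp hcont.tendsto
    rwa [hjz] at this
  have hright : ∀ᶠ e in 𝓝 (extChartAt (𝓡 d) (P z) (P z)), h (j e) = e :=
    (hh.hasStrictFDerivAt' hL hn).eventually_right_inverse
  have heq : F =ᶠ[𝓝 (P z)] (F ∘ P) ∘ (fun r ↦ j (extChartAt (𝓡 d) (P z) r)) := by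
    filter_upwards [hcont.eventually hright, extChartAt_source_mem_nhds (I := 𝓡 d) (P z),
      (hP.continuousAt.tendsto.comp hjc).eventually (extChartAt_source_mem_nhds (I := 𝓡 d) (P z))]
      with r h1 h2 h3
    exact congrArg F ((extChartAt (𝓡 d) (P z)).injOn h3 h2 h1).symm
  refine MDifferentiableAt.congr_of_eventuallyEq ?_ heq
  refine MDifferentiableAt.comp (I' := 𝓘(ℝ, E)) (P z) ?_ ?_
  · rw [hjz]
    exact hF.mdifferentiableAt
  · exact MDifferentiableAt.comp (I' := 𝓘(ℝ, EuclideanSpace ℝ (Fin d))) (P z)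
      (hj.differentiableAt (by simp)).mdifferentiableAt
      (mdifferentiableAt_extChartAt (mem_chart_source _ (P z)))

/-- For each period `T` (with `T = 0` meaning no periodicity) and each base point `a`, there is
a `T`-periodic function of slope at most one that locally separates `a` from other points. -/
theorem exists_periodic_separating (T a : ℝ) :
    ∃ φ : ℝ → ℝ, Differentiable ℝ φ ∧ (∀ s, |deriv φ s| ≤ 1) ∧
      (∀ s, ∀ k : ℤ, φ (s + k * T) = φ s) ∧ ∀ᶠ s in 𝓝[≠] a, φ s ≠ φ a := by
  rcases eq_or_ne T 0 with rfl | hT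
  · refine ⟨fun s ↦ s, differentiable_id, fun s ↦ by simp, fun s k ↦ by simp, ?_⟩
    filter_upwards [self_mem_nhdsWithin] with s hs using hs
  · have hd : ∀ s, HasDerivAt (fun s ↦ T / (2 * Real.pi) * Real.sin (2 * Real.pi / T * (s - a)))
        (Real.cos (2 * Real.pi / T * (s - a))) s := by
      intro s
      have h := (((hasDerivAt_id' s).sub_const a).const_mul (2 * Real.pi / T)).sin.const_mul
        (T / (2 * Real.pi))
      exact h.congr_deriv (by field_simp)
    refine ⟨_, fun s ↦ (hd s).differentiableAt, fun s ↦ ?_, fun s k ↦ ?_, ?_⟩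
    · rw [(hd s).deriv]
      exact Real.abs_cos_le_one _
    · have : 2 * Real.pi / T * (s + k * T - a)
          = 2 * Real.pi / T * (s - a) + k * (2 * Real.pi) := by
        field_simp
        ring
      simp only [this, Real.sin_add_int_mul_two_pi]
    · exact (hd a).eventually_ne (by simp)

/-! ### Time functions and timelike curves -/

namespace Spacetime

section Time

variable {d : ℕ} {M : Type*} [TopologicalSpace M] [ChartedSpace (EuclideanSpace ℝ (Fin d)) M]
  [IsManifold (𝓡 d) ∞ M] {g : Spacetime d M} {t : M → ℝ}

/-- The time orientation of a timelike vector can be read off from a time function. -/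
theorem IsCauchyTimeFunction.isFutureTimelike (ht : g.IsCauchyTimeFunction t) {p : M}
    {v : TangentSpace (𝓡 d) p} (hv : g.val p v v < 0)
    (hpos : (0 : ℝ) < mfderiv (𝓡 d) 𝓘(ℝ, ℝ) t p v) : g.IsFutureTimelike v := by
  refine ⟨hv, ?_⟩
  have hv0 : v ≠ 0 := by
    rintro rfl
    simp at hv
  by_contra! hle
  rcases hle.eq_or_lt with h0 | hlt
  · exact hv.not_gt (g.pos_of_orthogonal (g.orient_timelike p) hv0 h0.symm)
  · have h := ht.increasing p (-v) ⟨neg_ne_zero.2 hv0, by simpa using hv.le, by simpa using hlt⟩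
    have h' : (0 : ℝ) < -(mfderiv (𝓡 d) 𝓘(ℝ, ℝ) t p v) := by
      rw [← map_neg]; exact h
    exact (neg_pos.1 h').not_gt hpos

theorem IsCauchyTimeFunction.lt_of_mem_timelikePast (ht : g.IsCauchyTimeFunction t) {p q : M}
    (h : q ∈ g.timelikePast p) : t q < t p := by
  obtain ⟨γ, a, b, hγ, rfl, rfl⟩ := h
  refine hγ.rel_of_trans (R := fun a b ↦ a < b → t (γ a) < t (γ b)) ?_
    (fun x y z hxy hyz h1 h2 _ ↦ (h1 hxy).trans (h2 hyz)) ?_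
  · rintro c e ⟨hsm, htl⟩ hce
    have hcont : ContinuousOn (t ∘ γ) (Icc c e) :=
      ht.contMDiff.continuous.comp_continuousOn hsm.continuousOn
    refine strictMonoOn_of_deriv_pos (convex_Icc c e) hcont ?_ (left_mem_Icc.2 hce.le)
      (right_mem_Icc.2 hce.le) hce
    intro s hs
    rw [interior_Icc] at hs
    have hs' := Ioo_subset_Icc_self hs
    have hnhds : Icc c e ∈ 𝓝 s := Icc_mem_nhds hs.1 hs.2
    have hv := ht.increasing (γ s) (curveVelocity γ c e s) ⟨?_, (htl s hs').1.le, (htl s hs').2⟩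
    · have hd : MDifferentiableAt 𝓘(ℝ, ℝ) (𝓡 d) γ s :=
        (hsm.contMDiffAt hnhds).mdifferentiableAt (by simp)
      have ht' : MDifferentiableAt (𝓡 d) 𝓘(ℝ, ℝ) t (γ s) :=
        ht.contMDiff.mdifferentiableAt (by simp)
      have hcomp := mfderiv_comp s ht' hd
      rw [mfderiv_eq_fderiv] at hcomp
      rw [← fderiv_apply_one_eq_deriv, hcomp]
      rw [curveVelocity, mfderivWithin_of_mem_nhds hnhds] at hv
      exact hv
    · intro h0
      have := (htl s hs').1
      simp [h0] at this
  · obtain ⟨k, s, hs, rfl, rfl, -⟩ := hγ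
    exact hs (Fin.last_pos)

end Time

end Spacetime

/-! ### The metric in an adapted chart -/

namespace AdaptedChart

section Chart

variable {n : ℕ} {M : Type*} [TopologicalSpace M]
  [ChartedSpace (EuclideanSpace ℝ (Fin (n + 1))) M] [IsManifold (𝓡 (n + 1)) ∞ M]
  {S : Type*} [TopologicalSpace S]
  {g : Spacetime (n + 1) M} {Ψ : M ≃ₜ Ioi (0 : ℝ) × S} {tL : ℝ} (c : AdaptedChart g Ψ tL)

/-- The derivative of the parametrization: it sends coordinate vectors to tangent vectors. -/
noncomputable def dparam (z : ℝ × (Fin n → ℝ)) :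
    (ℝ × (Fin n → ℝ)) →L[ℝ] TangentSpace (𝓡 (n + 1)) (c.param z) :=
  mfderiv 𝓘(ℝ, ℝ × (Fin n → ℝ)) (𝓡 (n + 1)) c.param z

/-- The time-time component `g₀₀` of the metric. -/
noncomputable def timeComp (z : ℝ × (Fin n → ℝ)) : ℝ :=
  g.val (c.param z) (c.dparam z (1, 0)) (c.dparam z (1, 0))

theorem isOpen_domain : IsOpen (Ioo 0 tL ×ˢ c.V) := isOpen_Ioo.prod c.isOpen_V

theorem contMDiffAt_param {z : ℝ × (Fin n → ℝ)} (hz : z ∈ Ioo 0 tL ×ˢ c.V) :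
    ContMDiffAt 𝓘(ℝ, ℝ × (Fin n → ℝ)) (𝓡 (n + 1)) ∞ c.param z :=
  c.contMDiffOn_param.contMDiffAt (c.isOpen_domain.mem_nhds hz)

theorem hasMFDerivAt_param {z : ℝ × (Fin n → ℝ)} (hz : z ∈ Ioo 0 tL ×ˢ c.V) :
    HasMFDerivAt 𝓘(ℝ, ℝ × (Fin n → ℝ)) (𝓡 (n + 1)) c.param z (c.dparam z) :=
  ((c.contMDiffAt_param hz).mdifferentiableAt (by simp)).hasMFDerivAt

theorem bijective_dparam {z : ℝ × (Fin n → ℝ)} (hz : z ∈ Ioo 0 tL ×ˢ c.V) :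
    Function.Bijective (c.dparam z) :=
  c.bijective_mfderiv z.1 hz.1 z.2 hz.2

theorem continuousOn_val_dparam (v w : ℝ × (Fin n → ℝ)) :
    ContinuousOn (fun z ↦ g.val (c.param z) (c.dparam z v) (c.dparam z w))
      (Ioo 0 tL ×ˢ c.V) := by
  have hvec : ∀ v : ℝ × (Fin n → ℝ), ContinuousOn
      (fun z ↦ (⟨c.param z, c.dparam z v⟩ : TangentBundle (𝓡 (n + 1)) M)) (Ioo 0 tL ×ˢ c.V) := by
    intro v
    have h := c.contMDiffOn_param.continuousOn_tangentMapWithin (by simp)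
      c.isOpen_domain.uniqueMDiffOn
    have h2 : ContinuousOn (fun z : ℝ × (Fin n → ℝ) ↦
        (⟨z, v⟩ : TangentBundle 𝓘(ℝ, ℝ × (Fin n → ℝ)) (ℝ × (Fin n → ℝ))))
        (Ioo 0 tL ×ˢ c.V) := by
      have : Continuous fun z : ℝ × (Fin n → ℝ) ↦
          (tangentBundleModelSpaceHomeomorph 𝓘(ℝ, ℝ × (Fin n → ℝ))).symm (z, v) :=
        (tangentBundleModelSpaceHomeomorph _).symm.continuous.comp (by fun_prop)
      exact this.continuousOn
    refine (h.comp h2 fun z hz ↦ hz).congr fun z hz ↦ ?_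
    simp only [Function.comp_apply, tangentMapWithin, dparam,
      mfderivWithin_of_mem_nhds (c.isOpen_domain.mem_nhds hz)]
    rfl
  intro z hz
  have hg := (g.contMDiff.continuous.continuousAt (x := c.param z)).comp_continuousWithinAt
    (c.contMDiffOn_param.continuousOn z hz)
  have h : ContinuousWithinAt (fun z ↦ Bundle.TotalSpace.mk' ℝ (E := Bundle.Trivial M ℝ)
      (c.param z) (g.val (c.param z) (c.dparam z v) (c.dparam z w))) (Ioo 0 tL ×ˢ c.V) z :=
    hg.clm_bundle_apply₂ (F₁ := EuclideanSpace ℝ (Fin (n + 1)))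
      (F₂ := EuclideanSpace ℝ (Fin (n + 1))) (hvec v z hz) (hvec w z hz)
  simp only [FiberBundle.continuousWithinAt_totalSpace] at h
  exact h.2

theorem comp_symm (i j : Fin n) (τ : ℝ) (x : Fin n → ℝ) : c.comp i j τ x = c.comp j i τ x :=
  g.symm _ _ _

theorem dparam_spatial_eq_sum (z : ℝ × (Fin n → ℝ)) (v : Fin n → ℝ) :
    c.dparam z (0, v) = ∑ i, v i • c.dparam z (0, Pi.single i 1) := by
  simp_rw [← map_smul, ← map_sum]
  congr 1
  ext i
  · simp [Prod.fst_sum]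
  · simp [Prod.snd_sum, Finset.sum_apply, Pi.single_apply]

/-- The spatial part of the metric in coordinates. -/
theorem val_dparam_spatial (z v w) : g.val (c.param z) (c.dparam z (0, v)) (c.dparam z (0, w))
    = ∑ i, ∑ j, c.comp i j z.1 z.2 * (v i * w j) := by
  rw [c.dparam_spatial_eq_sum z v, c.dparam_spatial_eq_sum z w, Finset.sum_comm]
  simp only [map_sum, map_smul, _root_.sum_apply, _root_.smul_apply, smul_eq_mul, Finset.mul_sum]
  refine Finset.sum_congr rfl fun j _ ↦ Finset.sum_congr rfl fun i _ ↦ ?_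
  rw [show c.comp i j z.1 z.2 = g.val (c.param z) (c.dparam z (0, Pi.single i 1))
    (c.dparam z (0, Pi.single j 1)) from rfl]
  ring

theorem timeComp_neg {z : ℝ × (Fin n → ℝ)} (hz : z ∈ Ioo 0 tL ×ˢ c.V) : c.timeComp z < 0 :=
  c.time_time_neg z.1 hz.1 z.2 hz.2

theorem val_dparam_time_spatial {z : ℝ × (Fin n → ℝ)} (hz : z ∈ Ioo 0 tL ×ˢ c.V)
    (v : Fin n → ℝ) : g.val (c.param z) (c.dparam z (1, 0)) (c.dparam z (0, v)) = 0 := by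
  rw [c.dparam_spatial_eq_sum, map_sum]
  refine Finset.sum_eq_zero fun i _ ↦ ?_
  rw [map_smul, show g.val (c.param z) (c.dparam z (1, 0)) (c.dparam z (0, Pi.single i 1)) = 0
    from c.time_space_zero z.1 hz.1 z.2 hz.2 i, smul_zero]

theorem spatial_pos {z : ℝ × (Fin n → ℝ)} (hz : z ∈ Ioo 0 tL ×ˢ c.V) {v : Fin n → ℝ}
    (hv : v ≠ 0) : 0 < ∑ i, ∑ j, c.comp i j z.1 z.2 * (v i * v j) := by
  rw [← c.val_dparam_spatial]
  refine g.pos_of_orthogonal (c.timeComp_neg hz) ?_ (c.val_dparam_time_spatial hz v)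
  intro h0
  have := (c.bijective_dparam hz).1 (h0.trans (map_zero (c.dparam z)).symm)
  exact hv (Prod.ext_iff.1 this).2

theorem spatial_nonneg {z : ℝ × (Fin n → ℝ)} (hz : z ∈ Ioo 0 tL ×ˢ c.V) (v : Fin n → ℝ) :
    0 ≤ ∑ i, ∑ j, c.comp i j z.1 z.2 * (v i * v j) := by
  rcases eq_or_ne v 0 with rfl | hv
  · simp
  · exact (c.spatial_pos hz hv).le

theorem comp_self_nonneg {z : ℝ × (Fin n → ℝ)} (hz : z ∈ Ioo 0 tL ×ˢ c.V) (i : Fin n) :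
    0 ≤ c.comp i i z.1 z.2 := by
  have h := c.spatial_nonneg hz (Pi.single i 1)
  rw [← c.val_dparam_spatial] at h
  exact h

/-- Near the singularity, the spatial metric stretches the first coordinate by an arbitrarily
large factor, uniformly on compact sets. -/
theorem IsExpanding.eventually_le_spatial [NeZero n] {c : AdaptedChart g Ψ tL}
    (hc : c.IsExpanding) (htL : 0 < tL) {K : Set S} (hK : IsCompact K) (hKU : K ⊆ c.U) (C : ℝ) :
    ∀ᶠ τ in 𝓝[>] (0 : ℝ), ∀ x ∈ c.V, c.space x ∈ K → ∀ v : Fin n → ℝ,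
      C * v 0 ^ 2 ≤ ∑ i, ∑ j, c.comp i j τ x * (v i * v j) := by
  have hIoo : ∀ᶠ τ in 𝓝[>] (0 : ℝ), τ ∈ Ioo 0 tL := Ioo_mem_nhdsGT htL
  rcases hc.offDiagonal with h0 | hoff
  · filter_upwards [hc.diverges K hK hKU C, hIoo] with τ hτ hτL x hx hxK v
    refine le_trans (mul_le_mul_of_nonneg_right (hτ x hx hxK) (sq_nonneg _)) ?_
    refine mul_sq_le_sum_of_mixed_eq_zero (fun i j ↦ c.comp i j τ x) 0 (fun i hi ↦ ?_)
      (c.spatial_nonneg (z := (τ, x)) ⟨hτL, hx⟩) v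
    exact ⟨h0 i hi τ hτL x hx, (c.comp_symm i 0 τ x).trans (h0 i hi τ hτL x hx)⟩
  · have hn : (0 : ℝ) < n := Nat.cast_pos.2 (NeZero.pos n)
    set δ : ℝ := 1 / (2 * n) with hδ
    have hδ0 : 0 < δ := by positivity
    -- Only the case `i = j` of the condition is needed: it says `gₘᵢ² = o(gₘₘ gᵢᵢ)`.
    have hall : ∀ᶠ τ in 𝓝[>] (0 : ℝ), ∀ m i : Fin n, i < m → ∀ x ∈ c.V, c.space x ∈ K →
        |c.comp m i τ x * c.comp m i τ x| ≤ δ ^ 2 * |c.comp m m τ x * c.comp i i τ x| := by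
      rw [eventually_all]
      intro m
      rw [eventually_all]
      intro i
      by_cases him : i < m
      · filter_upwards [hoff m i i him him K hK hKU (δ ^ 2) (by positivity)] with τ h _ using h
      · exact Eventually.of_forall fun τ h ↦ absurd h him
    filter_upwards [hc.diverges K hK hKU (2 * C), hIoo, hall] with τ hτ hτL hsmall x hx hxK v
    have hdiag := c.comp_self_nonneg (z := (τ, x)) ⟨hτL, hx⟩
    have hlt : ∀ m i : Fin n, i < m →
        c.comp m i τ x ^ 2 ≤ δ ^ 2 * (c.comp m m τ x * c.comp i i τ x) := by
      intro m i him
      have h := hsmall m i him x hx hxK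
      rwa [abs_of_nonneg (mul_nonneg (hdiag m) (hdiag i)), abs_mul_self, ← sq] at h
    have h := half_mul_sq_le_sum_of_offDiagonal_small (fun i j ↦ c.comp i j τ x) hdiag hδ0.le
      (by rw [Fintype.card_fin, hδ]; field_simp; exact le_rfl) (fun i j hij ↦ ?_) 0 v
    · refine le_trans ?_ h
      nlinarith [mul_le_mul_of_nonneg_right (hτ x hx hxK) (sq_nonneg (v 0))]
    · rcases lt_or_gt_of_ne hij with hlt' | hlt'
      · rw [c.comp_symm, mul_comm (c.comp i i τ x)]
        exact hlt j i hlt'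
      · exact hlt i j hlt'

/-! ### Points and curves in an adapted chart -/

theorem exists_param_eq {r : M} (hr : ((Ψ r).1 : ℝ) < tL) (hU : (Ψ r).2 ∈ c.U) :
    ∃ x ∈ c.V, c.space x = (Ψ r).2 ∧ c.param (((Ψ r).1 : ℝ), x) = r := by
  rw [← c.image_space] at hU
  obtain ⟨x, hx, hxr⟩ := hU
  have h := c.splitting_param _ ⟨(Ψ r).1.2, hr⟩ x hx
  exact ⟨x, hx, hxr, Ψ.injective (Prod.ext (Subtype.ext h.1) (h.2.trans hxr))⟩

/-- A function of the first coordinate with the period of that coordinate descends to the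
spacetime. -/
theorem exists_descend [NeZero n] {φ : ℝ → ℝ} (hφ : ∀ s, ∀ k : ℤ, φ (s + k * c.period 0) = φ s) :
    ∃ F : M → ℝ, ∀ z ∈ Ioo 0 tL ×ˢ c.V, F (c.param z) = φ (z.2 0) := by
  classical
  refine ⟨fun r ↦ φ (Function.invFunOn c.space c.V (Ψ r).2 0), fun z hz ↦ ?_⟩
  have hmem : ∃ y ∈ c.V, c.space y = c.space z.2 := ⟨z.2, hz.2, rfl⟩
  have hV := Function.invFunOn_mem hmem
  have heq := Function.invFunOn_eq hmem
  obtain ⟨k, hk⟩ := (c.space_eq_iff _ hz.2 _ hV).1 heq.symm 0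
  simp only [(c.splitting_param z.1 hz.1 z.2 hz.2).2]
  rw [hk, hφ]

theorem mdifferentiableAt_of_descend [NeZero n] {φ : ℝ → ℝ} (hφ : Differentiable ℝ φ) {F : M → ℝ}
    (hF : ∀ z ∈ Ioo 0 tL ×ˢ c.V, F (c.param z) = φ (z.2 0)) {z : ℝ × (Fin n → ℝ)}
    (hz : z ∈ Ioo 0 tL ×ˢ c.V) : MDifferentiableAt (𝓡 (n + 1)) 𝓘(ℝ, ℝ) F (c.param z) := by
  refine MDifferentiableAt.of_comp_param (c.contMDiffAt_param hz)
    (c.bijective_mfderiv z.1 hz.1 z.2 hz.2) ?_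
  have : F ∘ c.param =ᶠ[𝓝 z] fun z ↦ φ (z.2 0) := by
    filter_upwards [c.isOpen_domain.mem_nhds hz] with y hy using hF y hy
  refine DifferentiableAt.congr_of_eventuallyEq ?_ this
  exact (hφ _).comp z (by fun_prop)

/-- The chain rule along the parametrization. -/
theorem mfderiv_dparam {F : M → ℝ} {G : ℝ × (Fin n → ℝ) → ℝ}
    (hF : ∀ z ∈ Ioo 0 tL ×ˢ c.V, F (c.param z) = G z) {z : ℝ × (Fin n → ℝ)}
    (hz : z ∈ Ioo 0 tL ×ˢ c.V) (hFd : MDifferentiableAt (𝓡 (n + 1)) 𝓘(ℝ, ℝ) F (c.param z))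
    {G' : (ℝ × (Fin n → ℝ)) →L[ℝ] ℝ} (hG : HasFDerivAt G G' z) (v : ℝ × (Fin n → ℝ)) :
    mfderiv (𝓡 (n + 1)) 𝓘(ℝ, ℝ) F (c.param z) (c.dparam z v) = G' v := by
  have h := hFd.hasMFDerivAt.comp z (c.hasMFDerivAt_param hz)
  have h2 : HasFDerivAt (F ∘ c.param) G' z := by
    refine hG.congr_of_eventuallyEq ?_
    filter_upwards [c.isOpen_domain.mem_nhds hz] with y hy using hF y hy
  exact DFunLike.congr_fun (hasMFDerivAt_unique h h2.hasMFDerivAt) v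

theorem mfderiv_time_dparam {t : M → ℝ} (ht : g.IsCauchyTimeFunction t)
    (hΨ : ∀ p, ((Ψ p).1 : ℝ) = t p) {z : ℝ × (Fin n → ℝ)} (hz : z ∈ Ioo 0 tL ×ˢ c.V)
    (v : ℝ × (Fin n → ℝ)) :
    mfderiv (𝓡 (n + 1)) 𝓘(ℝ, ℝ) t (c.param z) (c.dparam z v) = v.1 :=
  c.mfderiv_dparam (G := Prod.fst)
    (fun y hy ↦ (hΨ _).symm.trans (c.splitting_param y.1 hy.1 y.2 hy.2).1) hz
    (ht.contMDiff.mdifferentiableAt (by simp)) hasFDerivAt_fst v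

theorem curveVelocity_param {u : ℝ → ℝ × (Fin n → ℝ)} {u' : ℝ × (Fin n → ℝ)} {a b s : ℝ}
    (hab : a < b) (hs : s ∈ Icc a b) (hu : HasDerivAt u u' s) (hz : u s ∈ Ioo 0 tL ×ˢ c.V) :
    curveVelocity (d := n + 1) (fun s ↦ c.param (u s)) a b s = c.dparam (u s) u' := by
  have h := (c.hasMFDerivAt_param hz).comp_hasMFDerivWithinAt s (s := Icc a b)
    hu.hasFDerivAt.hasMFDerivAt.hasMFDerivWithinAt
  have huniq : UniqueMDiffWithinAt 𝓘(ℝ, ℝ) (Icc a b) s :=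
    (uniqueDiffOn_Icc hab s hs).uniqueMDiffWithinAt
  refine (congrArg (fun L : ℝ →L[ℝ] EuclideanSpace ℝ (Fin (n + 1)) ↦ L 1)
    (h.mfderivWithin huniq)).trans ?_
  change c.dparam (u s) ((1 : ℝ) • u') = c.dparam (u s) u'
  rw [one_smul]

end Chart

end AdaptedChart

/-! ### Lengths and timelike pasts in an adapted chart -/

namespace AdaptedChart

section Estimates

variable {n : ℕ} [NeZero n] {M : Type*} [TopologicalSpace M]
  [ChartedSpace (EuclideanSpace ℝ (Fin (n + 1))) M] [IsManifold (𝓡 (n + 1)) ∞ M]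
  {S : Type*} [TopologicalSpace S]
  {g : Spacetime (n + 1) M} {Ψ : M ≃ₜ Ioi (0 : ℝ) × S} {tL : ℝ} (c : AdaptedChart g Ψ tL)
  {t : M → ℝ}

/-- Where the spatial metric stretches the first coordinate by the factor `C`, a curve within a
time slice is at least `C` times as long as the change of any function of slope at most one of
that coordinate. -/
theorem mul_abs_sub_le_curveLength (ht : g.IsCauchyTimeFunction t)
    (hΨ : ∀ p, ((Ψ p).1 : ℝ) = t p) {K : Set S} (hKU : K ⊆ c.U) {τ : ℝ} (hτ : τ ∈ Ioo 0 tL)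
    {C : ℝ} (hC0 : 0 ≤ C)
    (hC : ∀ x ∈ c.V, c.space x ∈ K → ∀ v : Fin n → ℝ,
      C ^ 2 * v 0 ^ 2 ≤ ∑ i, ∑ j, c.comp i j τ x * (v i * v j))
    {φ : ℝ → ℝ} (hφ : Differentiable ℝ φ) (hφ1 : ∀ s, |deriv φ s| ≤ 1) {F : M → ℝ}
    (hF : ∀ z ∈ Ioo 0 tL ×ˢ c.V, F (c.param z) = φ (z.2 0)) {γ : ℝ → M}
    (hγ : IsPiecewiseSmooth (n + 1) γ 0 1)
    (hslice : ∀ s ∈ Icc (0 : ℝ) 1, t (γ s) = τ ∧ (Ψ (γ s)).2 ∈ K) :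
    ENNReal.ofReal (C * |F (γ 1) - F (γ 0)|) ≤ g.curveLength γ := by
  have hmem : ∀ s ∈ Icc (0 : ℝ) 1, ∃ x ∈ c.V, c.space x ∈ K ∧ c.param (τ, x) = γ s := by
    intro s hs
    have hts : ((Ψ (γ s)).1 : ℝ) = τ := (hΨ _).trans (hslice s hs).1
    obtain ⟨x, hx, hxs, hxγ⟩ := c.exists_param_eq (hts.trans_lt hτ.2) (hKU (hslice s hs).2)
    exact ⟨x, hx, hxs ▸ (hslice s hs).2, hts ▸ hxγ⟩
  have hFγ : ∀ s ∈ Icc (0 : ℝ) 1, MDifferentiableAt (𝓡 (n + 1)) 𝓘(ℝ, ℝ) F (γ s) := by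
    intro s hs
    obtain ⟨x, hx, -, hxγ⟩ := hmem s hs
    exact hxγ ▸ c.mdifferentiableAt_of_descend hφ hF ⟨hτ, hx⟩
  have hγc : ContinuousOn γ (Icc 0 1) :=
    HasPartition.continuousOn (hγ.mono fun _ _ h ↦ h.continuousOn)
  have hfc : ContinuousOn (F ∘ γ) (Icc 0 1) := fun s hs ↦
    (hFγ s hs).continuousAt.comp_continuousWithinAt (hγc s hs)
  obtain ⟨N, hN, hγN⟩ := hγ.exists_countable
    (Q := fun s ↦ MDifferentiableAt 𝓘(ℝ, ℝ) (𝓡 (n + 1)) γ s) fun a b hab s hs ↦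
      (hab.contMDiffAt (Icc_mem_nhds hs.1 hs.2)).mdifferentiableAt (by simp)
  have hspeed : ∀ s ∈ Ioo (0 : ℝ) 1 \ N, C * |deriv (F ∘ γ) s| ≤
      Real.sqrt (g.val (γ s) (curveVelocity γ 0 1 s) (curveVelocity γ 0 1 s)) := by
    intro s hs
    have hsI := Ioo_subset_Icc_self hs.1
    obtain ⟨x, hx, hxK, hxγ⟩ := hmem s hsI
    have hz : ((τ, x) : ℝ × (Fin n → ℝ)) ∈ Ioo 0 tL ×ˢ c.V := ⟨hτ, hx⟩
    have hd := hγN s hs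
    have hderiv : ∀ {G : M → ℝ}, MDifferentiableAt (𝓡 (n + 1)) 𝓘(ℝ, ℝ) G (γ s) →
        deriv (G ∘ γ) s = mfderiv (𝓡 (n + 1)) 𝓘(ℝ, ℝ) G (γ s) (curveVelocity γ 0 1 s) := by
      intro G hG
      have hcomp := mfderiv_comp s hG hd
      rw [mfderiv_eq_fderiv] at hcomp
      rw [← fderiv_apply_one_eq_deriv, hcomp, curveVelocity,
        mfderivWithin_of_mem_nhds (Icc_mem_nhds hs.1.1 hs.1.2)]
      rfl
    have hdt : deriv (t ∘ γ) s = 0 := by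
      have : t ∘ γ =ᶠ[𝓝 s] fun _ ↦ τ := by
        filter_upwards [Icc_mem_nhds hs.1.1 hs.1.2] with y hy using (hslice y hy).1
      rw [this.deriv_eq, deriv_const]
    have hdF := hderiv (hFγ s hsI)
    rw [hderiv (ht.contMDiff.mdifferentiableAt (by simp))] at hdt
    rw [hdF]
    have hFz := hFγ s hsI
    generalize curveVelocity (d := n + 1) γ 0 1 s = w at hdt ⊢
    generalize γ s = r at hxγ w hdt hFz ⊢
    subst hxγ
    obtain ⟨⟨a, v⟩, rfl⟩ := (c.bijective_dparam hz).2 w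
    rw [c.mfderiv_time_dparam ht hΨ hz] at hdt
    obtain rfl : a = 0 := hdt
    have hG : HasFDerivAt (fun z : ℝ × (Fin n → ℝ) ↦ φ (z.2 0))
        (deriv φ (x 0) • ((ContinuousLinearMap.proj (R := ℝ) (φ := fun _ : Fin n ↦ ℝ) 0).comp
          (ContinuousLinearMap.snd ℝ ℝ (Fin n → ℝ)))) (τ, x) :=
      (hφ _).hasDerivAt.comp_hasFDerivAt (τ, x)
        ((ContinuousLinearMap.proj (R := ℝ) (φ := fun _ : Fin n ↦ ℝ) 0).comp
          (ContinuousLinearMap.snd ℝ ℝ (Fin n → ℝ))).hasFDerivAt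
    rw [c.mfderiv_dparam hF hz hFz hG, c.val_dparam_spatial]
    refine Real.le_sqrt_of_sq_le (le_trans ?_ (hC x hx hxK v))
    change (C * |deriv φ (x 0) * v 0|) ^ 2 ≤ _
    rw [mul_pow, sq_abs, mul_pow]
    have h1 : deriv φ (x 0) ^ 2 ≤ 1 := by
      rw [← sq_abs]; exact pow_le_one₀ (abs_nonneg _) (hφ1 _)
    exact mul_le_mul_of_nonneg_left (mul_le_of_le_one_left (sq_nonneg _) h1) (sq_nonneg _)
  calc ENNReal.ofReal (C * |F (γ 1) - F (γ 0)|)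
      = ENNReal.ofReal C * ENNReal.ofReal |(F ∘ γ) 1 - (F ∘ γ) 0| := ENNReal.ofReal_mul hC0
    _ ≤ ENNReal.ofReal C * ∫⁻ s in Icc (0 : ℝ) 1, ENNReal.ofReal |deriv (F ∘ γ) s| := by
      gcongr
      refine ofReal_abs_sub_le_lintegral_abs_deriv zero_le_one hN hfc fun s hs ↦ ?_
      exact ((hFγ s (Ioo_subset_Icc_self hs.1)).comp s (hγN s hs)).differentiableAt
    _ = ∫⁻ s in Icc (0 : ℝ) 1, ENNReal.ofReal (C * |deriv (F ∘ γ) s|) := by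
      simp_rw [ENNReal.ofReal_mul hC0]
      rw [lintegral_const_mul]
      exact (measurable_deriv _).abs.ennreal_ofReal
    _ ≤ g.curveLength γ := by
      refine lintegral_mono_ae ?_
      rw [← restrict_Ioo_eq_restrict_Icc]
      filter_upwards [ae_restrict_mem measurableSet_Ioo,
        ae_restrict_of_ae (hN.ae_notMem volume)] with s hs hsN
      exact ENNReal.ofReal_le_ofReal (hspeed s ⟨hs, hsN⟩)

/-- A curve that moves in the first coordinate with speed `a` relative to the time `t` is
timelike as long as `a² g₁₁ < -g₀₀`. -/
theorem isFutureTimelike_dparam (ht : g.IsCauchyTimeFunction t) (hΨ : ∀ p, ((Ψ p).1 : ℝ) = t p)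
    {z : ℝ × (Fin n → ℝ)} (hz : z ∈ Ioo 0 tL ×ˢ c.V) {a : ℝ}
    (ha : c.timeComp z + a ^ 2 * c.comp 0 0 z.1 z.2 < 0) :
    g.IsFutureTimelike (c.dparam z (1, a • Pi.single 0 1)) := by
  refine ht.isFutureTimelike ?_ ?_
  · refine lt_of_eq_of_lt ?_ ha
    have h1 : c.dparam z (1, a • Pi.single 0 1)
        = c.dparam z (1, 0) + a • c.dparam z (0, Pi.single 0 1) := by
      rw [← map_smul, ← map_add]; simp
    have h2 := c.val_dparam_time_spatial hz (Pi.single 0 1)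
    have h3 : g.val (c.param z) (c.dparam z (0, Pi.single 0 1)) (c.dparam z (1, 0)) = 0 := by
      rw [g.symm]; exact h2
    rw [h1]
    simp only [map_add, map_smul, _root_.add_apply, _root_.smul_apply, smul_eq_mul, h2, h3]
    rw [show c.comp 0 0 z.1 z.2 = g.val (c.param z) (c.dparam z (0, Pi.single 0 1))
      (c.dparam z (0, Pi.single 0 1)) from rfl, timeComp]
    ring
  · rw [c.mfderiv_time_dparam ht hΨ hz]
    exact one_pos

/-- The timelike past of a point contains, at all early times, a segment in the direction of the
first coordinate whose coordinate length does not shrink as the time tends to zero. -/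
theorem eventually_param_mem_timelikePast (ht : g.IsCauchyTimeFunction t)
    (hΨ : ∀ p, ((Ψ p).1 : ℝ) = t p) {σ : ℝ} {x : Fin n → ℝ}
    (hz : ((σ, x) : ℝ × (Fin n → ℝ)) ∈ Ioo 0 tL ×ˢ c.V) :
    ∀ᶠ h in 𝓝 (0 : ℝ), x + h • Pi.single 0 1 ∈ c.V ∧ ∀ τ ∈ Ioo 0 (σ / 2),
      c.param (τ, x + h • Pi.single 0 1) ∈ g.timelikePast (c.param (σ, x)) := by
  have hσ : 0 < σ := hz.1.1
  -- The curves move sideways only during `[σ/2, σ]` and are vertical before, so that the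
  -- narrowing of the light cones as `t → 0` does not matter.
  set ψ : ℝ → ℝ := fun s ↦ Real.smoothTransition (2 * (σ - s) / σ) with hψ
  have hψs : ContDiff ℝ ∞ ψ := by
    refine Real.smoothTransition.contDiff.comp ?_
    fun_prop
  have hψσ : ψ σ = 0 := Real.smoothTransition.zero_of_nonpos (by simp)
  have hψ1 : ∀ s ≤ σ / 2, ψ s = 1 := fun s hs ↦
    Real.smoothTransition.one_of_one_le (by rw [le_div_iff₀ hσ]; linarith)
  have hψ' : Continuous (deriv ψ) := hψs.continuous_deriv (by simp)
  have hψ'0 : ∀ s < σ / 2, deriv ψ s = 0 := by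
    intro s hs
    have : ψ =ᶠ[𝓝 s] fun _ ↦ 1 := by
      filter_upwards [Iio_mem_nhds hs] with y hy using hψ1 y (le_of_lt hy)
    rw [this.deriv_eq, deriv_const]
  let u : ℝ → ℝ → ℝ × (Fin n → ℝ) := fun h s ↦ (s, x + (h * ψ s) • Pi.single 0 1)
  have hu : ∀ h s, HasDerivAt (u h) (1, (h * deriv ψ s) • Pi.single 0 1) s := by
    intro h s
    refine (hasDerivAt_id s).prodMk ?_
    exact ((((hψs.differentiable (by simp)) s).hasDerivAt.const_mul h).smul_const _).const_add x
  have hus : ∀ h, ContDiff ℝ ∞ (u h) := by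
    intro h
    refine contDiff_id.prodMk ?_
    exact contDiff_const.add ((contDiff_const.mul hψs).smul contDiff_const)
  have hucont : Continuous fun y : ℝ × ℝ ↦ u y.1 y.2 := by
    have := hψs.continuous
    fun_prop
  have hcompact : ∀ᶠ h in 𝓝 (0 : ℝ), ∀ s ∈ Icc (σ / 2) σ, u h s ∈ Ioo 0 tL ×ˢ c.V ∧
      c.timeComp (u h s) + (h * deriv ψ s) ^ 2 * c.comp 0 0 (u h s).1 (u h s).2 < 0 := by
    refine isCompact_Icc.eventually_forall_of_forall_eventually fun s hs ↦ ?_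
    have hus0 : u 0 s ∈ Ioo 0 tL ×ˢ c.V := by
      simpa [u] using
        (⟨⟨by linarith [hs.1], hs.2.trans_lt hz.1.2⟩, hz.2⟩ : (0 < s ∧ s < tL) ∧ x ∈ c.V)
    have hn := c.isOpen_domain.mem_nhds hus0
    have hut : Tendsto (fun y : ℝ × ℝ ↦ u y.1 y.2) (𝓝 (0, s)) (𝓝 (u 0 s)) :=
      hucont.tendsto (0, s)
    refine (hut.eventually hn).and ?_
    have h00 : ContinuousAt (fun z : ℝ × (Fin n → ℝ) ↦ c.comp 0 0 z.1 z.2) (u 0 s) :=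
      (c.continuousOn_val_dparam (0, Pi.single 0 1) (0, Pi.single 0 1)).continuousAt hn
    have htt : ContinuousAt c.timeComp (u 0 s) :=
      (c.continuousOn_val_dparam (1, 0) (1, 0)).continuousAt hn
    have hcoef : Continuous fun y : ℝ × ℝ ↦ (y.1 * deriv ψ y.2) ^ 2 := by fun_prop
    have hlim := (htt.tendsto.comp hut).add
      ((hcoef.tendsto (0, s)).mul (h00.tendsto.comp hut))
    refine hlim.eventually_lt_const ?_
    simpa using c.timeComp_neg hus0
  filter_upwards [hcompact] with h hh
  have hxV : x + h • Pi.single 0 1 ∈ c.V := by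
    have := (hh (σ / 2) ⟨le_rfl, by linarith⟩).1.2
    simpa [u, hψ1 _ le_rfl] using this
  refine ⟨hxV, fun τ hτ ↦ ?_⟩
  have hτσ : τ < σ := by linarith [hτ.2]
  have hall : ∀ s ∈ Icc τ σ, u h s ∈ Ioo 0 tL ×ˢ c.V ∧
      c.timeComp (u h s) + (h * deriv ψ s) ^ 2 * c.comp 0 0 (u h s).1 (u h s).2 < 0 := by
    intro s hs
    rcases le_or_gt (σ / 2) s with hs2 | hs2
    · exact hh s ⟨hs2, hs.2⟩
    · have hmem : u h s ∈ Ioo 0 tL ×ˢ c.V := by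
        refine ⟨⟨hτ.1.trans_le hs.1, hs.2.trans_lt hz.1.2⟩, ?_⟩
        simpa [u, hψ1 s hs2.le] using hxV
      refine ⟨hmem, ?_⟩
      simpa [hψ'0 s hs2] using c.timeComp_neg hmem
  refine ⟨fun s ↦ c.param (u h s), τ, σ, hasPartition_of_lt hτσ ⟨?_, fun s hs ↦ ?_⟩, ?_, ?_⟩
  · exact c.contMDiffOn_param.comp (hus h).contMDiff.contMDiffOn fun s hs ↦ (hall s hs).1
  · rw [c.curveVelocity_param hτσ hs (hu h s) (hall s hs).1]
    exact c.isFutureTimelike_dparam ht hΨ (hall s hs).1 (hall s hs).2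
  · simp [u, hψ1 τ hτ.2.le]
  · simp [u, hψσ]

/-! ### Divergence of the diameters -/

/-- If the past of `p` stays in a compact part of an adapted chart, then the pasts of its points
`q` become infinitely wide within the past of `p`. -/
theorem IsExpanding.tendsto_diamIn {c : AdaptedChart g Ψ tL} (hc : c.IsExpanding)
    (ht : g.IsCauchyTimeFunction t) (hΨ : ∀ p, ((Ψ p).1 : ℝ) = t p) {p q : M} (hp : t p < tL)
    {K : Set S} (hK : IsCompact K) (hKU : K ⊆ c.U)
    (hpast : ∀ r ∈ g.timelikePast p, (Ψ r).2 ∈ K) (hq : q ∈ g.timelikePast p) :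
    Tendsto (fun τ ↦ g.diamIn (g.timelikePast q ∩ {r | t r = τ})
      (g.timelikePast p ∩ {r | t r = τ})) (𝓝[>] 0) (𝓝 ⊤) := by
  have hqL : ((Ψ q).1 : ℝ) < tL := by
    rw [hΨ]; exact (ht.lt_of_mem_timelikePast hq).trans hp
  obtain ⟨x, hxV, -, hxq⟩ := c.exists_param_eq hqL (hKU (hpast q hq))
  set σ : ℝ := ((Ψ q).1 : ℝ)
  have hσ : σ ∈ Ioo 0 tL := ⟨(Ψ q).1.2, hqL⟩
  obtain ⟨φ, hφ, hφ1, hφper, hφsep⟩ := exists_periodic_separating (c.period 0) (x 0)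
  obtain ⟨F, hF⟩ := c.exists_descend hφper
  have hseg := c.eventually_param_mem_timelikePast ht hΨ ⟨hσ, hxV⟩
  rw [hxq] at hseg
  have hsep : ∀ᶠ h in 𝓝[≠] (0 : ℝ), φ (x 0 + h) ≠ φ (x 0) := by
    have hlim : Tendsto (fun h : ℝ ↦ x 0 + h) (𝓝[≠] 0) (𝓝[≠] (x 0)) := by
      refine tendsto_nhdsWithin_iff.2 ⟨?_, ?_⟩
      · have : Continuous fun h : ℝ ↦ x 0 + h := by fun_prop
        simpa using (this.tendsto 0).mono_left nhdsWithin_le_nhds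
      · filter_upwards [self_mem_nhdsWithin] with h hh using by simpa using hh
    exact hlim.eventually hφsep
  obtain ⟨h, ⟨hyV, hy⟩, hφh⟩ := ((hseg.filter_mono nhdsWithin_le_nhds).and hsep).exists
  obtain ⟨-, hx⟩ := hseg.self_of_nhds
  simp only [zero_smul, add_zero] at hx
  have hD : 0 < |φ (x 0 + h) - φ (x 0)| := abs_pos.2 (sub_ne_zero.2 hφh)
  set D := |φ (x 0 + h) - φ (x 0)| with hDdef
  rw [ENNReal.tendsto_nhds_top_iff_nnreal]
  intro B
  set C : ℝ := (B + 1) / D with hCdef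
  have hC0 : 0 ≤ C := by positivity
  filter_upwards [hc.eventually_le_spatial (hσ.1.trans hσ.2) hK hKU (C ^ 2),
    Ioo_mem_nhdsGT (half_pos hσ.1)] with τ hτ hτσ
  have hτL : τ ∈ Ioo 0 tL := ⟨hτσ.1, by linarith [hτσ.2, hσ.1, hσ.2]⟩
  have htime : ∀ y ∈ c.V, t (c.param (τ, y)) = τ := fun y hy ↦
    (hΨ _).symm.trans (c.splitting_param τ hτL y hy).1
  have hB : (B : ℝ≥0∞) < ENNReal.ofReal (C * D) := by
    rw [hCdef, div_mul_cancel₀ _ hD.ne', ENNReal.lt_ofReal_iff_toReal_lt ENNReal.coe_ne_top]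
    simp
  refine hB.trans_le ?_
  refine le_iSup₂_of_le (c.param (τ, x)) ⟨hx τ hτσ, htime x hxV⟩ ?_
  refine le_iSup₂_of_le (c.param (τ, x + h • Pi.single 0 1)) ⟨hy τ hτσ, htime _ hyV⟩ ?_
  refine le_iInf₂ fun γ hγ ↦ ?_
  obtain ⟨hγs, hγB, hγ0, hγ1⟩ := hγ
  have hlen := c.mul_abs_sub_le_curveLength ht hΨ hKU hτL hC0 hτ hφ hφ1 hF hγs
    fun s hs ↦ ⟨(hγB s hs).2, hpast _ (hγB s hs).1⟩
  rw [hγ0, hγ1, hF (τ, x) ⟨hτL, hxV⟩,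
    hF (τ, x + h • Pi.single 0 1) ⟨hτL, hyV⟩] at hlen
  simpa [hDdef] using hlen

end Estimates

end AdaptedChart

theorem lemma6p1 {n : ℕ} [NeZero n] {M : Type*} [TopologicalSpace M] [T2Space M]
    [SecondCountableTopology M] [ChartedSpace (EuclideanSpace ℝ (Fin (n + 1))) M]
    [IsManifold (𝓡 (n + 1)) ∞ M] {S : Type*} [TopologicalSpace S]
    (g : Spacetime (n + 1) M) (hg : g.IsGloballyHyperbolic)
    (t : M → ℝ) (ht : g.IsCauchyTimeFunction t)
    (Ψ : M ≃ₜ Ioi (0 : ℝ) × S) (hΨ : ∀ p, ((Ψ p).1 : ℝ) = t p)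
    (tL : ℝ) (htL : 0 < tL)
    (hcover : ∀ p : M, t p < tL →
      ∃ c : AdaptedChart g Ψ tL, c.IsExpanding ∧ (Ψ p).2 ∈ c.U)
    (hcompact :
      (CompactSpace S ∧ ∃ c : AdaptedChart g Ψ tL, c.IsExpanding ∧ c.U = univ) ∨
      (∀ p : M, t p < tL → ∃ c : AdaptedChart g Ψ tL, c.IsExpanding ∧
        ∃ K : Set S, IsCompact K ∧ K ⊆ c.U ∧ ∀ q ∈ g.timelikePast p, (Ψ q).2 ∈ K)) :
    g.HasExpandingSingularityTowardsPast := by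
  refine ⟨hg, t, ht, tL, htL, fun p hp q hq ↦ ?_⟩
  obtain ⟨c, hc, K, hK, hKU, hpast⟩ : ∃ c : AdaptedChart g Ψ tL, c.IsExpanding ∧
      ∃ K : Set S, IsCompact K ∧ K ⊆ c.U ∧ ∀ q ∈ g.timelikePast p, (Ψ q).2 ∈ K := by
    rcases hcompact with ⟨hS, c, hc, hU⟩ | h
    · exact ⟨c, hc, univ, isCompact_univ, hU.ge, fun _ _ ↦ mem_univ _⟩
    · exact h p hp
  have hlim : Tendsto (fun i : ℕ ↦ 1 / ((i : ℝ) + 1)) atTop (𝓝[>] 0) :=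
    tendsto_nhdsWithin_iff.2 ⟨tendsto_one_div_add_atTop_nhds_zero_nat,
      Eventually.of_forall fun _ ↦ mem_Ioi.2 Nat.one_div_pos_of_nat⟩
  refine ⟨fun i : ℕ ↦ 1 / ((i : ℝ) + 1), fun i j hij ↦ Nat.one_div_lt_one_div hij,
    fun i ↦ Nat.one_div_pos_of_nat, hlim.mono_right nhdsWithin_le_nhds, ?_⟩
  exact (hc.tendsto_diamIn ht hΨ hp hK hKU hpast hq).comp hlim
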